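/- Conventions. Let $S(D)=(X(D)\mid Z(D))\in\mathbb F_q[D]^{(n-k)\times 2n}$ have a polynomial right inverse ($S$ is basic) and satisfy $X(D)Z(1/D)^t-Z(D)X(1/D)^t=0$. Suppose moreover that its overall constraint length $\gamma=\sum_i\max_j\deg S_{ij}$ is smallest among all basic matrices generating the same $\mathbb F_q[D]$-module ($S$ is reduced), and let $\mu=\max_{i,j}\deg S_{ij}$. Then $S$ is a stabilizer matrix of an asymmetric quantum convolutional code (AQCC) with frame size $n$, $k$ logical qudits per frame, memory $\mu$ and degree $\gamma$. The stabilizer, up to scalars, consists of the Pauli operators on the semi-infinite stream of frames $0,1,2,\dots$ of $n$ qudits whose labels $(a(D)\mid b(D))$ lie in the $\mathbb F_q[D]$-row module of $S(D)$; here $(a\mid b)$ labels the product of the operators $X(a_{j,s})Z(b_{j,s})$ on qudit $j$ of frame $s$, where $a_j(D)=\sum_s a_{j,s}D^s$ and $b_j(D)=\sum_s b_{j,s}D^s$. An error is detected if, up to a scalar, it belongs to the stabilizer, or if it fails to commute with some element of the stabilizer. The free distance $(d_z)_f$ (resp. $(d_x)_f$) is the minimum weight (number of nonidentity tensor components) of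 an undetected error consisting of phase-shifts $Z(b)$ only (resp. of qudit-flips $X(a)$ only). The parameters are written $[(n,k,\mu;\gamma,(d_z)_f/(d_x)_f)]_q$; the code is of CSS type if $S(D)=\begin{pmatrix}H_2(D)&0\\0&H_1(D)\end{pmatrix}$. Theorem. Let $q=2^l$ with $l\ge 4$, $n=q+1$ and $a=q/2$. (a) For all integers $i,t$ with $3\le i\le a-1$ and $1\le t\le i-2$ there is, for some memory $\mu^*$, an AQCC of CSS type with parameters $[(n,2i-2t-2,\mu^*;6,(d_z)_f/(d_x)_f)]_q$ such that $(d_z)_f\ge n-2i-1$ and $(d_x)_f\ge 2t+3$. (b) For all integers $i,t$ with $2\le i\le a-1$ and $1\le t\le i-1$ there is, for some memory $\mu^*$, an AQCC of CSS type with parameters $[(n,2i-2t,\mu^*;4,(d_z)_f/(d_x)_f)]_q$ such that $(d_z)_f\ge n-2i-1$ and $(d_x)_f\ge 2t+3$. -/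

import Mathlib

open scoped Polynomial

namespace QConv

noncomputable section

/-! ### Polynomial generator matrices over a field -/

section Generator

variable {F : Type*} [Field F] {ι m : Type*} [Fintype ι] [Fintype m]

/-- A polynomial matrix is basic if it has a polynomial right inverse. -/
def IsBasic [DecidableEq ι] (G : Matrix ι m F[X]) : Prop :=
  ∃ R : Matrix m ι F[X], G * R = 1

/-- The `F[D]`-module `{u(D) G(D)}` generated by the rows of `G(D)`. -/
def rowModule (G : Matrix ι m F[X]) : Submodule F[X] (m → F[X]) :=
  Submodule.span F[X] (Set.range fun i => G i)

/-- The `i`-th constraint length `γ_i = max_j deg g_ij`. -/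
def constraintLength (G : Matrix ι m F[X]) (i : ι) : ℕ :=
  Finset.univ.sup fun j => (G i j).natDegree

/-- The overall constraint length `∑ γ_i`. -/
def overallConstraintLength (G : Matrix ι m F[X]) : ℕ :=
  ∑ i, constraintLength G i

/-- The memory `max_i γ_i`. -/
def memory (G : Matrix ι m F[X]) : ℕ :=
  Finset.univ.sup fun i => constraintLength G i

/-- A basic matrix is reduced if its overall constraint length is smallest among all basic
matrices generating the same module; the overall constraint length is then the degree. -/
def IsReducedBasic [DecidableEq ι] (G : Matrix ι m F[X]) : Prop :=
  IsBasic G ∧ ∀ G' : Matrix ι m F[X], IsBasic G' → rowModule G' = rowModule G →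
    overallConstraintLength G ≤ overallConstraintLength G'

end Generator

/-! ### Pauli errors on a semi-infinite stream of qudits

The stream is divided into frames of `n` qudits. An element of the infinite Pauli group with
finitely many nonidentity tensor components is, up to a scalar, the product of the operators
`X(a_{j,s}) Z(b_{j,s})` acting on the `j`-th qudit of the `s`-th frame, `s = 0, 1, 2, …`. It is
labelled by the vector `(a(D) | b(D))`, with `a_j(D) = ∑_s a_{j,s} D^s` and
`b_j(D) = ∑_s b_{j,s} D^s`. -/

section Pauli

variable {F : Type*} [Field F] {n : ℕ}

/-- Label `(a(D) | b(D))` of a finitely supported Pauli operator. -/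
abbrev PauliLabel (F : Type*) [Field F] (n : ℕ) : Type _ := (Fin n ⊕ Fin n) → F[X]

/-- The number of nonidentity tensor components. -/
def PauliLabel.weight (E : PauliLabel F n) : ℕ :=
  ∑ j : Fin n, ((E (Sum.inl j)).support ∪ (E (Sum.inr j)).support).card

/-- Only qudit-flips `X(a)` occur. -/
def PauliLabel.IsXType (E : PauliLabel F n) : Prop := ∀ j, E (Sum.inr j) = 0

/-- Only phase-shifts `Z(b)` occur. -/
def PauliLabel.IsZType (E : PauliLabel F n) : Prop := ∀ j, E (Sum.inl j) = 0

/-- The Euclidean inner product `⟨u(D) | v(D)⟩ = ∑_s u_s · v_s` of finite sequences of frames. -/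
def euclideanForm (u v : Fin n → F[X]) : F :=
  ∑ j : Fin n, (u j).sum fun s c => c * (v j).coeff s

/-- The trace map from a finite field to its prime field. -/
def absoluteTrace (F : Type*) [Field F] (x : F) : ZMod (ringChar F) :=
  letI := ZMod.algebra F (ringChar F)
  Algebra.trace (ZMod (ringChar F)) F x

/-- Since `Z(b) X(a) = ω^{tr(ab)} X(a) Z(b)`, the operators with labels `(a | b)` and `(a' | b')`
commute iff `tr (⟨a | b'⟩ - ⟨a' | b⟩) = 0`. -/
def PauliLabel.Commutes (E E' : PauliLabel F n) : Prop :=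
  absoluteTrace F (euclideanForm (fun j => E (Sum.inl j)) (fun j => E' (Sum.inr j))
    - euclideanForm (fun j => E' (Sum.inl j)) (fun j => E (Sum.inr j))) = 0

end Pauli

/-! ### Stabilizer matrices and asymmetric quantum convolutional codes -/

section Stabilizer

variable {F : Type*} [Field F] {n : ℕ} {ι : Type*} [Fintype ι]

/-- Substitution `D ↦ D` into Laurent polynomials, entrywise. -/
def toLaurentMatrix (M : Matrix ι (Fin n) F[X]) : Matrix ι (Fin n) (LaurentPolynomial F) :=
  M.map fun f => Polynomial.toLaurent f

/-- Substitution `D ↦ 1/D`, entrywise. -/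
def toLaurentMatrixInv (M : Matrix ι (Fin n) F[X]) : Matrix ι (Fin n) (LaurentPolynomial F) :=
  M.map fun f => LaurentPolynomial.invert (Polynomial.toLaurent f)

/-- Symplectic orthogonality `X(D) Z(1/D)ᵗ - Z(D) X(1/D)ᵗ = 0` of `S(D) = (X(D) | Z(D))`. -/
def SymplecticOrthogonal (S : Matrix ι (Fin n ⊕ Fin n) F[X]) : Prop :=
  toLaurentMatrix S.toCols₁ * (toLaurentMatrixInv S.toCols₂).transpose
    - toLaurentMatrix S.toCols₂ * (toLaurentMatrixInv S.toCols₁).transpose = 0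

/-- The error is detected by the code with stabilizer matrix `S(D)`: either it belongs (up to a
scalar) to the stabilizer, or it fails to commute with an element of the stabilizer. The labels of
stabilizer elements are the `F`-linear combinations of the rows `D^s S_i(D)`, `s = 0, 1, 2, …`, of
the semi-infinite stabilizer matrix, i.e. the elements of the row module of `S(D)`. -/
def Detects (S : Matrix ι (Fin n ⊕ Fin n) F[X]) (E : PauliLabel F n) : Prop :=
  E ∈ rowModule S ∨ ∃ s ∈ rowModule S, ¬ E.Commutes s

/-- `d` is the free distance with respect to the errors of the class `P`: all errors of the class
of weight less than `d` are detected, but some error of the class of weight `d` is not. -/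
def HasFreeDistance (S : Matrix ι (Fin n ⊕ Fin n) F[X]) (P : PauliLabel F n → Prop)
    (d : ℕ) : Prop :=
  (∀ E, P E → E.weight < d → Detects S E) ∧ ∃ E, P E ∧ E.weight = d ∧ ¬ Detects S E

/-- `S(D)` is a (reduced basic) stabilizer matrix of a quantum convolutional code with asymmetric
parameters `[(n, k, μ; γ, d_z / d_x)]_q`, `q` the order of `F`. -/
structure HasAsymmetricParameters [DecidableEq ι] (S : Matrix ι (Fin n ⊕ Fin n) F[X])
    (k μ γ dz dx : ℕ) : Prop where
  orthogonal : SymplecticOrthogonal S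
  reduced : IsReducedBasic S
  rows : Fintype.card ι + k = n
  memory_eq : memory S = μ
  degree_eq : overallConstraintLength S = γ
  zDistance : HasFreeDistance S PauliLabel.IsZType dz
  xDistance : HasFreeDistance S PauliLabel.IsXType dx

/-- There is an AQCC of CSS type over `F` with parameters `[(n, k, μ; γ, d_z / d_x)]_q`, that is,
one whose stabilizer matrix has the form `(H₂(D) | 0 ; 0 | H₁(D))`. -/
def ExistsAQCC (F : Type*) [Field F] (n k μ γ dz dx : ℕ) : Prop :=
  ∃ (r₁ r₂ : ℕ) (H₁ : Matrix (Fin r₁) (Fin n) F[X]) (H₂ : Matrix (Fin r₂) (Fin n) F[X]),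
    HasAsymmetricParameters (Matrix.fromBlocks H₂ 0 0 H₁) k μ γ dz dx

end Stabilizer

end

end QConv

namespace QConv

section

open Matrix Polynomial

/-! The construction starts from two orthogonal MDS block codes of length `q + 1` on the projective
line and makes each of them convolutional by delaying one extra row.

Let `r + s + 2m = q + 1`, and let `φ` be monic of degree `2m` with no zero in `F`. The forms `φ·g`
with `g` of degree `r - 1`, and the forms of degree `s - 1`, are evaluated at all rational points. A
product of one of each has degree `q - 1`, so its values sum to zero (`sum_projEval_mul`).
Multiplying by `φ` only rescales coordinates, so a nonzero vector orthogonal to the first code has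
weight above `r`, and one orthogonal to the second has weight above `s`
(`exists_sum_projEval_ne_zero`).

Since `2m ≥ 2`, each code can be enlarged by one vector without losing independence or mutual
orthogonality (`exists_linearIndependent_option_mul_transpose_eq_zero`). The extra vector,
multiplied by `D^d`, is added to an existing row: the number of rows stays `r` or `s`, the degree
becomes `d`, and the constant terms are still the MDS rows. Pairing the last nonzero frame of an
error with those constant terms gives the distance bounds. The extra vectors themselves are
undetected errors, so the free distances exist. Reducedness is certified by a determinant whose
degree equals the overall constraint length (`isReducedBasic_of_natDegree_det`). -/

/-! ### Evaluation codes on the projective line. -/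

theorem sum_eval_eq_neg_coeff {F : Type*} [Field F] [Fintype F] (f : F[X])
    (hf : f.natDegree < Fintype.card F) :
    ∑ x : F, f.eval x = -f.coeff (Fintype.card F - 1) := by
  classical
  have hq : 1 < Fintype.card F := Fintype.one_lt_card
  have key : ∀ i < Fintype.card F, ∑ x : F, x ^ i = if i = Fintype.card F - 1 then (-1 : F) else 0 := by
    intro i hi
    split_ifs with h
    · subst h
      have h1 : ∀ x : F, x ^ (Fintype.card F - 1) = 1 - if x = 0 then 1 else 0 := by
        intro x
        split_ifs with hx
        · subst hx; rw [zero_pow (by omega)]; simp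
        · rw [FiniteField.pow_card_sub_one_eq_one x hx]; simp
      simp [h1]
    · exact FiniteField.sum_pow_lt_card_sub_one F i (by omega)
  simp_rw [eval_eq_sum_range' hf]
  rw [Finset.sum_comm]
  simp_rw [← Finset.mul_sum]
  rw [Finset.sum_congr rfl fun i hi => by rw [key i (Finset.mem_range.1 hi)]]
  simp [Fintype.card_pos]

/-- Evaluation of `p`, as a binary form of degree `r - 1`, at the points of the projective line. -/
noncomputable def projEval {F : Type*} [Field F] (r : ℕ) (p : F[X]) : Option F → F
  | none => p.coeff (r - 1)
  | some x => p.eval x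

/-- The affine points contribute minus the coefficient of `X^(q-1)` in `f * g`, and the point at
infinity contributes that same coefficient. -/
theorem sum_projEval_mul {F : Type*} [Field F] [Fintype F] {r s : ℕ} {f g : F[X]}
    (hr : 0 < r) (hs : 0 < s) (hf : f.natDegree < r) (hg : g.natDegree < s)
    (h : r + s = Fintype.card F + 1) :
    ∑ P, projEval r f P * projEval s g P = 0 := by
  have h1 : (f * g).natDegree < Fintype.card F := by
    have := natDegree_mul_le (p := f) (q := g); omega
  have h2 := sum_eval_eq_neg_coeff _ h1
  have h3 : Fintype.card F - 1 = (r - 1) + (s - 1) := by omega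
  rw [h3, coeff_mul_add_eq_of_natDegree_le (by omega) (by omega)] at h2
  simp only [eval_mul] at h2
  simp [Fintype.sum_option, projEval, h2]

/-- The sequences orthogonal to all binary forms of degree `r - 1` multiplied by a form without
rational zeros have weight more than `r`. -/
theorem exists_sum_projEval_ne_zero {F : Type*} [Field F] [Fintype F] [DecidableEq F] {r k : ℕ}
    {φ : F[X]} (hφ : φ.Monic) (hk : φ.natDegree = k) (hroot : ∀ x, φ.eval x ≠ 0)
    {v : Option F → F} (hv : v ≠ 0) (hw : (Finset.univ.filter fun P => v P ≠ 0).card ≤ r) :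
    ∃ l : Fin r, ∑ P, projEval (r + k) (φ * X ^ (l : ℕ)) P * v P ≠ 0 := by
  by_contra! hc
  have hr : 0 < r := by
    obtain ⟨P, hP⟩ := Function.ne_iff.1 hv
    exact lt_of_lt_of_le (Finset.card_pos.2 ⟨P, by simpa using hP⟩) hw
  have key : ∀ p : F[X], p.natDegree < r →
      p.coeff (r - 1) * v none + ∑ x, φ.eval x * p.eval x * v (some x) = 0 := by
    intro p hp
    have hterm : ∀ l : Fin r, (if (l : ℕ) = r - 1 then (1 : F) else 0) * v none
        + ∑ x, φ.eval x * x ^ (l : ℕ) * v (some x) = 0 := by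
      intro l
      have h0 := hc l
      rw [Fintype.sum_option] at h0
      simp only [projEval, eval_mul, eval_pow, eval_X] at h0
      -- The value at infinity is the coefficient in degree `r + k - 1`; as `φ` is monic of degree
      -- `k`, only `l = r - 1` reaches it.
      have h1 : (φ * X ^ (l : ℕ)).coeff (r + k - 1) = if (l : ℕ) = r - 1 then (1 : F) else 0 := by
        split_ifs with h
        · rw [show r + k - 1 = k + l by omega, coeff_mul_X_pow, ← hk, hφ.coeff_natDegree]
        · refine coeff_eq_zero_of_natDegree_lt ?_
          rw [natDegree_mul_X_pow _ hφ.ne_zero, hk]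
          have := l.2; omega
      rwa [h1] at h0
    calc p.coeff (r - 1) * v none + ∑ x, φ.eval x * p.eval x * v (some x)
        = ∑ l : Fin r, p.coeff l * ((if (l : ℕ) = r - 1 then (1 : F) else 0) * v none
          + ∑ x, φ.eval x * x ^ (l : ℕ) * v (some x)) := by
          simp_rw [mul_add, Finset.sum_add_distrib]
          congr 1
          · rw [Finset.sum_eq_single (⟨r - 1, by omega⟩ : Fin r)]
            · simp
            · intro b _ hb
              have : (b : ℕ) ≠ r - 1 := fun h => hb (Fin.ext h)
              simp [this]
            · simp
          · simp_rw [Finset.mul_sum]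
            rw [Finset.sum_comm]
            refine Finset.sum_congr rfl fun x _ => ?_
            rw [eval_eq_sum_range' hp, ← Fin.sum_univ_eq_sum_range (fun i => p.coeff i * x ^ i),
              Finset.mul_sum, Finset.sum_mul]
            exact Finset.sum_congr rfl fun i _ => by ring
      _ = 0 := Finset.sum_eq_zero fun l _ => by rw [hterm, mul_zero]
  set T : Finset F := Finset.univ.filter fun x => v (some x) ≠ 0 with hT
  have hcard : (Finset.univ.filter fun P => v P ≠ 0).card
      = (if v none ≠ 0 then 1 else 0) + T.card := by
    rw [Finset.card_filter, Fintype.sum_option, hT, Finset.card_filter]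
  have hzero : ∀ (U : Finset F) (x : F), x ∈ U → (∏ y ∈ U, (X - C y)).eval x = 0 := by
    intro U x hx
    rw [eval_prod]
    exact Finset.prod_eq_zero hx (by simp)
  by_cases h0 : v none = 0
  · obtain ⟨P, hP⟩ := Function.ne_iff.1 hv
    cases P with
    | none => exact hP h0
    | some a =>
      have ha : a ∈ T := by simpa [hT] using hP
      -- A polynomial vanishing on the support except at `a` isolates the single term at `a`.
      have hd : (∏ y ∈ T.erase a, (X - C y)).natDegree < r := by
        rw [natDegree_finsetProd_X_sub_C_eq_card, Finset.card_erase_of_mem ha]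
        have := Finset.card_pos.2 ⟨a, ha⟩
        rw [if_neg (not_not.2 h0)] at hcard
        omega
      have h1 := key _ hd
      rw [h0, mul_zero, zero_add, Finset.sum_eq_single a] at h1
      · refine absurd h1 (mul_ne_zero (mul_ne_zero (hroot a) ?_) (by simpa using hP))
        rw [eval_prod, Finset.prod_ne_zero_iff]
        intro y hy
        simpa [sub_eq_zero] using (Finset.ne_of_mem_erase hy).symm
      · intro b _ hb
        by_cases hbT : b ∈ T
        · rw [hzero _ b (Finset.mem_erase.2 ⟨hb, hbT⟩)]; simp
        · have : v (some b) = 0 := by simpa [hT] using hbT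
          rw [this, mul_zero]
      · simp
  · have hTc : T.card + 1 ≤ r := by
      rw [if_pos h0] at hcard; omega
    -- Here the point at infinity is isolated: `p` kills the affine support, and the power of `X`
    -- pads its degree to exactly `r - 1`, so that its value at infinity is 1.
    set p : F[X] := (∏ y ∈ T, (X - C y)) * X ^ (r - 1 - T.card) with hp
    have hm : (∏ y ∈ T, (X - C y)).Monic := monic_prod_of_monic _ _ fun y _ => monic_X_sub_C y
    have hd : p.natDegree = r - 1 := by
      rw [hp, natDegree_mul_X_pow _ hm.ne_zero, natDegree_finsetProd_X_sub_C_eq_card]; omega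
    have h1 := key p (by omega)
    have hpm : p.Monic := hm.mul (monic_X_pow _)
    rw [← hd, hpm.coeff_natDegree, one_mul, Finset.sum_eq_zero, add_zero] at h1
    · exact h0 h1
    · intro b _
      by_cases hbT : b ∈ T
      · rw [hp, eval_mul, hzero _ b hbT]; simp
      · have : v (some b) = 0 := by simpa [hT] using hbT
        rw [this, mul_zero]

theorem linearIndependent_projEval {F : Type*} [Field F] [Fintype F] {r k : ℕ} {φ : F[X]}
    (hroot : ∀ x, φ.eval x ≠ 0) (hr : r ≤ Fintype.card F) :
    LinearIndependent F fun l : Fin r => projEval (r + k) (φ * X ^ (l : ℕ)) := by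
  classical
  rw [Fintype.linearIndependent_iff]
  intro c hc
  set p : F[X] := ∑ l : Fin r, C (c l) * X ^ (l : ℕ) with hp
  have hd : p.degree < Fintype.card F := by
    refine lt_of_le_of_lt (degree_sum_le _ _) ((Finset.sup_lt_iff (WithBot.bot_lt_coe _)).2 ?_)
    intro l _
    refine lt_of_le_of_lt (degree_C_mul_X_pow_le _ _) ?_
    exact_mod_cast lt_of_lt_of_le l.2 hr
  have h0 : p = 0 := by
    refine eq_zero_of_degree_lt_of_eval_finset_eq_zero Finset.univ (by simpa using hd) ?_
    intro x _
    have h1 := congrFun hc (some x)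
    simp only [Finset.sum_apply, Pi.smul_apply, projEval, eval_mul, eval_pow, eval_X,
      smul_eq_mul, Pi.zero_apply] at h1
    refine (mul_eq_zero.1 ?_).resolve_left (hroot x)
    rw [← h1, hp, eval_finsetSum, Finset.mul_sum]
    exact Finset.sum_congr rfl fun l _ => by simp; ring
  intro l
  have h1 := congrArg (fun f => f.coeff (l : ℕ)) h0
  simp only [hp, finsetSum_coeff, coeff_C_mul_X_pow, coeff_zero] at h1
  rw [Finset.sum_eq_single l] at h1
  · simpa using h1
  · intro b _ hb
    rw [if_neg]
    exact fun h => hb (Fin.ext h.symm)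
  · simp

/-- The map `x ↦ x² + x` takes the value 0 at both 0 and -1, so on a finite field it misses some
`c`; powers of the rootless quadratic `X² + X - c` serve. -/
theorem exists_monic_natDegree_eval_ne_zero (F : Type*) [Field F] [Fintype F] (m : ℕ) :
    ∃ φ : F[X], φ.Monic ∧ φ.natDegree = 2 * m ∧ ∀ x, φ.eval x ≠ 0 := by
  have h : ¬ Function.Injective fun x : F => x ^ 2 + x := fun h => by
    have := @h 0 (-1) (by norm_num)
    norm_num at this
  rw [Finite.injective_iff_surjective] at h
  simp only [Function.Surjective, not_forall, not_exists] at h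
  obtain ⟨c, hc⟩ := h
  have hm : (X ^ 2 + X - C c : F[X]).Monic := by monicity!
  have hd : (X ^ 2 + X - C c : F[X]).natDegree = 2 := by compute_degree!
  refine ⟨(X ^ 2 + X - C c) ^ m, hm.pow m, ?_, ?_⟩
  · rw [hm.natDegree_pow, hd, mul_comm]
  · intro x
    simpa using pow_ne_zero m (sub_ne_zero.2 (hc x))

/-! ### Dimension count and a determinantal criterion for reducedness. -/

theorem exists_dotProduct_eq_zero_notMem_span {F : Type*} [Field F] {n : ℕ} {ι κ : Type*}
    [Fintype ι] [Fintype κ] (v : ι → Fin n → F) (w : κ → Fin n → F)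
    (h : Fintype.card ι + Fintype.card κ < n) :
    ∃ x, (∀ i, v i ⬝ᵥ x = 0) ∧ x ∉ Submodule.span F (Set.range w) := by
  by_contra! hc
  have hle : LinearMap.ker (Matrix.of v).mulVecLin ≤ Submodule.span F (Set.range w) := by
    intro x hx
    refine hc x fun i => ?_
    exact congrFun (LinearMap.mem_ker.1 hx) i
  have h1 := Submodule.finrank_mono hle
  have h2 := finrank_range_le_card (R := F) w
  have h3 := (Matrix.of v).mulVecLin.finrank_range_add_finrank_ker
  have h4 := Submodule.finrank_le (LinearMap.range (Matrix.of v).mulVecLin)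
  simp only [Module.finrank_fintype_fun_eq_card, Fintype.card_fin, Set.finrank] at h2 h3 h4
  omega

theorem natDegree_det_le_overallConstraintLength {F : Type*} [Field F] {ι m : Type*} [Fintype ι]
    [DecidableEq ι] [Fintype m] (S : Matrix ι m F[X]) (K : Matrix m ι F) :
    (S * K.map C).det.natDegree ≤ overallConstraintLength S := by
  have hent : ∀ i j, ((S * K.map C) i j).natDegree ≤ constraintLength S i := by
    intro i j
    rw [Matrix.mul_apply]
    refine natDegree_sum_le_of_forall_le _ _ fun l _ => ?_
    rw [Matrix.map_apply]
    exact (natDegree_mul_C_le _ _).trans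
      (Finset.le_sup (f := fun j => (S i j).natDegree) (Finset.mem_univ l))
  rw [Matrix.det_apply]
  refine natDegree_sum_le_of_forall_le _ _ fun σ _ => ?_
  rw [natDegree_smul_of_smul_regular _ (isSMulRegular_of_group _)]
  refine (natDegree_prod_le _ _).trans ((Finset.sum_le_sum fun i _ => hent _ _).trans_eq ?_)
  exact Equiv.sum_comp σ _

/-- If `S = U S'`, then `det (S K)` and `det (S' K)` differ by the unit `det U` and have the same
degree, which bounds the constraint length of `S'` from below. -/
theorem isReducedBasic_of_natDegree_det {F : Type*} [Field F] {ι m : Type*} [Fintype ι]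
    [DecidableEq ι] [Fintype m] {S : Matrix ι m F[X]} (hS : IsBasic S) (K : Matrix m ι F)
    (hK : overallConstraintLength S ≤ (S * K.map C).det.natDegree) : IsReducedBasic S := by
  refine ⟨hS, fun S' _ hmod => hK.trans ?_⟩
  obtain ⟨R, hR⟩ := hS
  have hrow : ∀ i, ∃ u : ι → F[X], u ᵥ* S' = S i := by
    intro i
    have : S i ∈ rowModule S' := hmod ▸ Submodule.subset_span ⟨i, rfl⟩
    obtain ⟨c, hc⟩ := (Submodule.mem_span_range_iff_exists_fun _).1 this
    exact ⟨c, by rw [← hc, Matrix.vecMul_eq_sum]⟩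
  choose U hU using hrow
  have hUS : (Matrix.of U) * S' = S := by
    refine Matrix.ext fun i j => ?_
    exact congrFun (hU i) j
  -- From `U (S' R) = S R = 1`, the square matrix `U` is invertible.
  have hdet : IsUnit (Matrix.of U).det := by
    rw [← Matrix.isUnit_iff_isUnit_det]
    refine IsUnit.of_mul_eq_one (S' * R) ?_
    rw [← Matrix.mul_assoc, hUS, hR]
  rw [← hUS, Matrix.mul_assoc, Matrix.det_mul]
  refine natDegree_mul_le.trans ?_
  rw [natDegree_eq_zero_of_isUnit hdet, zero_add]
  exact natDegree_det_le_overallConstraintLength S' K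

/-! ### Convolutional matrices obtained by delaying one extra row. -/

section ShiftedRow

variable {F : Type*} [Field F] {ι m : Type*} [Fintype ι] [DecidableEq ι] [Fintype m]

/-- The matrix `(I | D^d e_{i₀})`. -/
noncomputable def shiftMatrix (F : Type*) [Field F] {ι : Type*} [DecidableEq ι] (i₀ : ι) (d : ℕ) :
    Matrix ι (Option ι) F[X] :=
  Matrix.of fun i o => o.elim (if i = i₀ then X ^ d else 0) fun j => if i = j then 1 else 0

/-- The generator matrix with rows `g_i`, `i ≠ i₀`, and `g_{i₀} + D^d g_none`. -/
noncomputable def shiftedRow (G : Matrix (Option ι) m F) (i₀ : ι) (d : ℕ) : Matrix ι m F[X] :=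
  shiftMatrix F i₀ d * G.map C

theorem shiftedRow_apply (G : Matrix (Option ι) m F) (i₀ : ι) (d : ℕ) (i : ι) (j : m) :
    shiftedRow G i₀ d i j = C (G (some i) j) + if i = i₀ then X ^ d * C (G none j) else 0 := by
  simp [shiftedRow, shiftMatrix, Matrix.mul_apply, Fintype.sum_option, add_comm]

theorem overallConstraintLength_shiftedRow_le (G : Matrix (Option ι) m F) (i₀ : ι) (d : ℕ) :
    overallConstraintLength (shiftedRow G i₀ d) ≤ d := by
  have h : ∀ i, constraintLength (shiftedRow G i₀ d) i ≤ if i = i₀ then d else 0 := by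
    intro i
    refine Finset.sup_le fun j _ => ?_
    rw [shiftedRow_apply]
    split_ifs
    · refine natDegree_add_le_of_degree_le (by simp) ?_
      rw [mul_comm]
      exact natDegree_C_mul_X_pow_le _ _
    · simp
  refine (Finset.sum_le_sum fun i _ => h i).trans ?_
  simp

theorem exists_rightInverse_of_linearIndependent {G : Matrix ι m F}
    (hG : LinearIndependent F G) : ∃ R : Matrix m ι F, G * R = 1 := by
  classical
  have h1 : Function.Surjective G.mulVec := by
    rw [← Matrix.coe_mulVecLin, ← LinearMap.range_eq_top]
    refine Submodule.eq_top_of_finrank_eq ?_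
    rw [Module.finrank_fintype_fun_eq_card]
    exact LinearIndependent.rank_matrix hG
  exact Matrix.mulVec_surjective_iff_exists_right_inverse.1 h1

variable {G : Matrix (Option ι) m F} (hG : LinearIndependent F G) (i₀ : ι) (d : ℕ)
include hG

theorem isBasic_shiftedRow : IsBasic (shiftedRow G i₀ d) := by
  obtain ⟨R, hR⟩ := exists_rightInverse_of_linearIndependent hG
  -- Keeps the identity block of `(I | D^d e_{i₀})` and drops the last column.
  set K : Matrix (Option ι) ι F[X] := Matrix.of fun o j =>
    o.elim 0 fun i => if i = j then 1 else 0 with hK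
  refine ⟨R.map C * K, ?_⟩
  have h : G.map C * R.map C = 1 := by
    rw [← Matrix.map_mul, hR, Matrix.map_one _ (map_zero _) (map_one _)]
  rw [shiftedRow, Matrix.mul_assoc, ← Matrix.mul_assoc (G.map C), h, Matrix.one_mul]
  refine Matrix.ext fun i j => ?_
  simp [Matrix.mul_apply, Fintype.sum_option, Matrix.one_apply, shiftMatrix, hK]

theorem exists_det_shiftedRow : ∃ K : Matrix m ι F, (shiftedRow G i₀ d * K.map C).det = X ^ d := by
  obtain ⟨R, hR⟩ := exists_rightInverse_of_linearIndependent hG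
  -- Replaces column `i₀` of the identity block by the column `D^d e_{i₀}`, leaving a diagonal
  -- matrix of determinant `D^d`.
  set K : Matrix (Option ι) ι F := Matrix.of fun o j =>
    o.elim (if j = i₀ then 1 else 0) fun i => if j = i₀ then 0 else if i = j then 1 else 0 with hK
  refine ⟨R * K, ?_⟩
  have h : G.map C * R.map C = 1 := by
    rw [← Matrix.map_mul, hR, Matrix.map_one _ (map_zero _) (map_one _)]
  rw [shiftedRow, Matrix.mul_assoc, Matrix.map_mul, ← Matrix.mul_assoc (G.map C), h, Matrix.one_mul]
  have : shiftMatrix F i₀ d * K.map C = Matrix.diagonal fun i => if i = i₀ then X ^ d else 1 := by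
    refine Matrix.ext fun i j => ?_
    simp only [Matrix.mul_apply, Fintype.sum_option, shiftMatrix, Matrix.of_apply, K,
      Option.elim, Matrix.map_apply, Matrix.diagonal_apply]
    by_cases hj : j = i₀
    · simp [hj]; aesop
    · simp [hj]; aesop
  rw [this, Matrix.det_diagonal]
  simp

/-- Makes the extra row usable as an error outside the stabilizer. In the independent rows of `G`, a
combination of the shifted rows has its own coefficients as `some`-coordinates; these would all
vanish, and the `none`-coordinate with them. -/
theorem notMem_rowModule_shiftedRow :
    (fun j => C (G none j)) ∉ rowModule (shiftedRow G i₀ d) := by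
  intro hmem
  obtain ⟨R, hR⟩ := exists_rightInverse_of_linearIndependent hG
  have h : G.map C * R.map C = 1 := by
    rw [← Matrix.map_mul, hR, Matrix.map_one _ (map_zero _) (map_one _)]
  obtain ⟨c, hc⟩ := (Submodule.mem_span_range_iff_exists_fun _).1 hmem
  have h1 : c ᵥ* shiftedRow G i₀ d = Pi.single none 1 ᵥ* G.map C := by
    rw [Matrix.vecMul_eq_sum, hc]
    ext1 j
    simp
  have h2 := congrArg (fun v => v ᵥ* R.map C) h1
  simp only [shiftedRow, Matrix.vecMul_vecMul, Matrix.mul_assoc, h, Matrix.mul_one] at h2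
  simp only [Matrix.vecMul_one] at h2
  have h3 : ∀ j, c j = 0 := fun j => by
    have := congrFun h2 (some j)
    simpa [Matrix.vecMul, dotProduct, shiftMatrix, Matrix.one_apply] using this
  have h4 := congrFun h2 none
  simp [Matrix.vecMul, dotProduct, shiftMatrix, h3] at h4

end ShiftedRow

theorem dotProduct_eq_zero_of_mem_rowModule {F : Type*} [Field F] {ι m : Type*} [Fintype ι]
    [DecidableEq ι] [Fintype m] {G : Matrix (Option ι) m F} {i₀ : ι} {d : ℕ} {h : m → F}
    (hh : G *ᵥ h = 0) {s : m → F[X]} (hs : s ∈ rowModule (shiftedRow G i₀ d)) :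
    s ⬝ᵥ (fun j => C (h j)) = 0 := by
  obtain ⟨c, rfl⟩ := (Submodule.mem_span_range_iff_exists_fun _).1 hs
  rw [← Matrix.vecMul_eq_sum, ← Matrix.dotProduct_mulVec]
  have : shiftedRow G i₀ d *ᵥ (fun j => C (h j)) = 0 := by
    rw [shiftedRow, ← Matrix.mulVec_mulVec]
    have h1 : G.map C *ᵥ (fun j => C (h j)) = 0 := by
      ext1 o
      have := congrArg C (congrFun hh o)
      simpa [Matrix.mulVec, dotProduct] using this
    rw [h1, Matrix.mulVec_zero]
  rw [this, dotProduct_zero]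

/-! ### Orthogonality, the Euclidean form and the trace. -/

theorem toLaurentMatrix_shiftedRow_mul {F : Type*} [Field F] {n : ℕ} {ι κ : Type*} [Fintype ι]
    [DecidableEq ι] [Fintype κ] [DecidableEq κ] {G : Matrix (Option ι) (Fin n) F}
    {H : Matrix (Option κ) (Fin n) F} (h : G * Hᵀ = 0) (i₀ : ι) (k₀ : κ) (d e : ℕ) :
    toLaurentMatrix (shiftedRow G i₀ d) * (toLaurentMatrixInv (shiftedRow H k₀ e))ᵀ = 0 := by
  have h1 : toLaurentMatrix (G.map C) * (toLaurentMatrixInv (H.map C))ᵀ = 0 := by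
    refine Matrix.ext fun i j => ?_
    have := congrArg (LaurentPolynomial.C (R := F)) (congrFun (congrFun h i) j)
    simpa [toLaurentMatrix, toLaurentMatrixInv, Matrix.mul_apply] using this
  rw [toLaurentMatrix, toLaurentMatrixInv] at h1 ⊢
  have h2 : ∀ (A : Matrix ι (Option ι) F[X]) (B : Matrix κ (Option κ) F[X]),
      (A * G.map C).map (fun f => Polynomial.toLaurent f) *
        ((B * H.map C).map (fun f => LaurentPolynomial.invert (Polynomial.toLaurent f)))ᵀ = 0 := by
    intro A B
    have hA := Matrix.map_mul (L := A) (M := G.map C) (f := (Polynomial.toLaurent (R := F)))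
    have hB := Matrix.map_mul (L := B) (M := H.map C)
      (f := ((LaurentPolynomial.invert (R := F)).toRingEquiv.toRingHom.comp Polynomial.toLaurent))
    change (A * G.map C).map Polynomial.toLaurent *
      ((B * H.map C).map ((LaurentPolynomial.invert (R := F)).toRingEquiv.toRingHom.comp
        Polynomial.toLaurent))ᵀ = 0
    rw [hA, hB, Matrix.transpose_mul, Matrix.mul_assoc, ← Matrix.mul_assoc ((G.map C).map _)]
    erw [h1]
    simp
  exact h2 _ _

section EuclideanForm

variable {F : Type*} [Field F] {n : ℕ}

theorem euclideanForm_eq_sum_range (u v : Fin n → F[X]) {N : ℕ} (hN : ∀ j, (u j).natDegree < N) :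
    euclideanForm u v = ∑ j, ∑ s ∈ Finset.range N, (u j).coeff s * (v j).coeff s :=
  Finset.sum_congr rfl fun j _ => sum_over_range' _ (by simp) _ (hN j)

theorem exists_natDegree_lt (u : Fin n → F[X]) : ∃ N, ∀ j, (u j).natDegree < N :=
  ⟨Finset.univ.sup (fun j => (u j).natDegree) + 1, fun j =>
    Nat.lt_succ_of_le (Finset.le_sup (f := fun j => (u j).natDegree) (Finset.mem_univ j))⟩

theorem euclideanForm_comm (u v : Fin n → F[X]) : euclideanForm u v = euclideanForm v u := by
  obtain ⟨M, hM⟩ := exists_natDegree_lt u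
  obtain ⟨N, hN⟩ := exists_natDegree_lt v
  rw [euclideanForm_eq_sum_range u v (N := max M N) fun j => lt_max_of_lt_left (hM j),
    euclideanForm_eq_sum_range v u (N := max M N) fun j => lt_max_of_lt_right (hN j)]
  simp_rw [mul_comm]

theorem euclideanForm_smul_right (c : F) (u v : Fin n → F[X]) :
    euclideanForm u (C c • v) = euclideanForm u v * c := by
  obtain ⟨N, hN⟩ := exists_natDegree_lt u
  rw [euclideanForm_eq_sum_range _ _ hN, euclideanForm_eq_sum_range _ _ hN, Finset.sum_mul]
  refine Finset.sum_congr rfl fun j _ => ?_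
  rw [Finset.sum_mul]
  refine Finset.sum_congr rfl fun s _ => ?_
  simp only [Pi.smul_apply, smul_eq_mul, coeff_C_mul]
  ring

theorem euclideanForm_zero_left (u : Fin n → F[X]) : euclideanForm (fun _ => 0) u = 0 := by
  simp [euclideanForm]

theorem euclideanForm_zero_right (u : Fin n → F[X]) : euclideanForm u (fun _ => 0) = 0 := by
  simp [euclideanForm, Polynomial.sum]

theorem euclideanForm_C_left (h : Fin n → F) (u : Fin n → F[X]) :
    euclideanForm (fun j => C (h j)) u = (u ⬝ᵥ fun j => C (h j)).coeff 0 := by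
  rw [euclideanForm_eq_sum_range _ _ (N := 1) (by simp), dotProduct, finsetSum_coeff]
  exact Finset.sum_congr rfl fun j _ => by simp [mul_comm]

/-- A sequence whose last frame is not orthogonal to the constant terms of some row is not
orthogonal to the row module. -/
theorem exists_euclideanForm_ne_zero [DecidableEq F] {ι : Type*} [Fintype ι] {H : Matrix ι (Fin n) F[X]} {r : ℕ}
    (hH : ∀ v : Fin n → F, v ≠ 0 → (Finset.univ.filter fun j => v j ≠ 0).card ≤ r →
      ∃ i, ∑ j, (H i j).coeff 0 * v j ≠ 0)
    {b : Fin n → F[X]} (hb : b ≠ 0) (hw : ∑ j, (b j).support.card ≤ r) :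
    ∃ u ∈ rowModule H, euclideanForm b u ≠ 0 := by
  classical
  obtain ⟨j₀, hj₀⟩ := Function.ne_iff.1 hb
  have hne : (Finset.univ.filter fun j => b j ≠ 0).Nonempty := ⟨j₀, by simpa using hj₀⟩
  obtain ⟨j₁, hj₁, hmax⟩ := Finset.exists_max_image _ (fun j => (b j).natDegree) hne
  set T := (b j₁).natDegree with hT
  have hdeg : ∀ j, (b j).natDegree < T + 1 := by
    intro j
    by_cases hj : b j = 0
    · simp [hj]
    · exact Nat.lt_succ_of_le (hmax j (by simpa using hj))
  obtain ⟨i, hi⟩ := hH (fun j => (b j).coeff T)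
    (fun h => (leadingCoeff_ne_zero.2 (Finset.mem_filter.1 hj₁).2) (congrFun h j₁)) (by
      refine le_trans ?_ hw
      rw [Finset.card_filter]
      refine Finset.sum_le_sum fun j _ => ?_
      split_ifs with h
      · exact Finset.card_pos.2 ⟨T, mem_support_iff.2 h⟩
      · exact Nat.zero_le _)
  -- Shifting by the last frame index `T` puts the constant term of the row on frame `T`; earlier
  -- frames of the shifted row are zero and later frames of `b` are zero.
  refine ⟨(X ^ T : F[X]) • H i, Submodule.smul_mem _ _ (Submodule.subset_span ⟨i, rfl⟩), ?_⟩
  rw [euclideanForm_eq_sum_range _ _ hdeg]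
  convert hi using 1
  refine Finset.sum_congr rfl fun j _ => ?_
  rw [Finset.sum_range_succ, Finset.sum_eq_zero]
  · simp [coeff_X_pow_mul', mul_comm ((b j).coeff T)]
  · intro s hs
    have := Finset.mem_range.1 hs
    simp [coeff_X_pow_mul', this]

theorem exists_absoluteTrace_mul_ne_zero [Finite F] {a : F} (ha : a ≠ 0) :
    ∃ c, absoluteTrace F (a * c) ≠ 0 :=
  letI := ZMod.algebra F (ringChar F)
  FiniteField.trace_to_zmod_nondegenerate F ha

theorem absoluteTrace_zero : absoluteTrace F 0 = 0 := by
  simp [absoluteTrace]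

end EuclideanForm

/-! ### Detection and free distance for CSS matrices. -/

section CSS

variable {F : Type*} [Field F] {n : ℕ} {ι κ : Type*} [Fintype ι] [Fintype κ]
  {A : Matrix ι (Fin n) F[X]} {B : Matrix κ (Fin n) F[X]}

theorem mem_rowModule_fromBlocks {E : PauliLabel F n} :
    E ∈ rowModule (fromBlocks A 0 0 B) ↔
      (fun j => E (Sum.inl j)) ∈ rowModule A ∧ (fun j => E (Sum.inr j)) ∈ rowModule B := by
  simp only [rowModule, Submodule.mem_span_range_iff_exists_fun, ← Matrix.vecMul_eq_sum]
  constructor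
  · rintro ⟨c, rfl⟩
    refine ⟨⟨c ∘ Sum.inl, ?_⟩, ⟨c ∘ Sum.inr, ?_⟩⟩ <;> ext1 j <;> simp [Matrix.vecMul_fromBlocks]
  · rintro ⟨⟨c, hc⟩, d, hd⟩
    refine ⟨Sum.elim c d, ?_⟩
    ext1 j
    cases j with
    | inl j => simpa [Matrix.vecMul_fromBlocks] using congrFun hc j
    | inr j => simpa [Matrix.vecMul_fromBlocks] using congrFun hd j

theorem zero_mem_rowModule (A : Matrix ι (Fin n) F[X]) : (fun _ => 0) ∈ rowModule A :=
  Submodule.zero_mem _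

theorem detects_of_isZType [Finite F] [DecidableEq F] {r : ℕ}
    (hA : ∀ v : Fin n → F, v ≠ 0 → (Finset.univ.filter fun j => v j ≠ 0).card ≤ r →
      ∃ i, ∑ j, (A i j).coeff 0 * v j ≠ 0)
    {E : PauliLabel F n} (hE : E.IsZType) (hw : E.weight < r + 1) :
    Detects (fromBlocks A 0 0 B) E := by
  have hl : (fun j => E (Sum.inl j)) = fun _ => 0 := funext hE
  by_cases hb : (fun j => E (Sum.inr j)) = 0
  · refine Or.inl (mem_rowModule_fromBlocks.2 ?_)
    rw [hl, hb]
    exact ⟨zero_mem_rowModule A, zero_mem_rowModule B⟩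
  · obtain ⟨u, hu, hne⟩ := exists_euclideanForm_ne_zero hA hb (by
      refine le_trans (Finset.sum_le_sum fun j _ => ?_) (Nat.le_of_lt_succ hw)
      exact Finset.card_le_card Finset.subset_union_right)
    -- A nonzero inner product may have trace zero; rescaling the stabilizer element by `c` avoids
    -- this.
    obtain ⟨c, hc⟩ := exists_absoluteTrace_mul_ne_zero (neg_ne_zero.2 hne)
    refine Or.inr ⟨Sum.elim (C c • u) fun _ => 0, mem_rowModule_fromBlocks.2
      ⟨Submodule.smul_mem _ _ hu, zero_mem_rowModule B⟩, ?_⟩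
    rw [PauliLabel.Commutes]
    simp only [Sum.elim_inl, Sum.elim_inr, hl]
    rw [euclideanForm_zero_right, zero_sub, euclideanForm_comm]
    have h1 := euclideanForm_smul_right c (fun j => E (Sum.inr j)) u
    change ¬ absoluteTrace F (-euclideanForm _ (C c • u)) = 0
    rwa [h1, ← neg_mul]

theorem detects_of_isXType [Finite F] [DecidableEq F] {r : ℕ}
    (hB : ∀ v : Fin n → F, v ≠ 0 → (Finset.univ.filter fun j => v j ≠ 0).card ≤ r →
      ∃ i, ∑ j, (B i j).coeff 0 * v j ≠ 0)
    {E : PauliLabel F n} (hE : E.IsXType) (hw : E.weight < r + 1) :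
    Detects (fromBlocks A 0 0 B) E := by
  have hl : (fun j => E (Sum.inr j)) = fun _ => 0 := funext hE
  by_cases hb : (fun j => E (Sum.inl j)) = 0
  · refine Or.inl (mem_rowModule_fromBlocks.2 ?_)
    rw [hl, hb]
    exact ⟨zero_mem_rowModule A, zero_mem_rowModule B⟩
  · obtain ⟨u, hu, hne⟩ := exists_euclideanForm_ne_zero hB hb (by
      refine le_trans (Finset.sum_le_sum fun j _ => ?_) (Nat.le_of_lt_succ hw)
      exact Finset.card_le_card Finset.subset_union_left)
    obtain ⟨c, hc⟩ := exists_absoluteTrace_mul_ne_zero hne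
    refine Or.inr ⟨Sum.elim (fun _ => 0) (C c • u), mem_rowModule_fromBlocks.2
      ⟨zero_mem_rowModule A, Submodule.smul_mem _ _ hu⟩, ?_⟩
    rw [PauliLabel.Commutes]
    simp only [Sum.elim_inl, Sum.elim_inr, hl]
    rw [euclideanForm_zero_right, sub_zero]
    have h1 := euclideanForm_smul_right c (fun j => E (Sum.inl j)) u
    change ¬ absoluteTrace F (euclideanForm _ (C c • u)) = 0
    rwa [h1]

theorem not_detects_zType {h : Fin n → F}
    (hA : ∀ s ∈ rowModule A, s ⬝ᵥ (fun j => C (h j)) = 0)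
    (hB : (fun j => C (h j)) ∉ rowModule B) :
    ¬ Detects (fromBlocks A 0 0 B) (Sum.elim (fun _ => 0) fun j => C (h j)) := by
  rintro (hmem | ⟨s, hs, hc⟩)
  · exact hB (mem_rowModule_fromBlocks.1 hmem).2
  · apply hc
    have := hA _ (mem_rowModule_fromBlocks.1 hs).1
    rw [PauliLabel.Commutes]
    simp only [Sum.elim_inl, Sum.elim_inr]
    rw [euclideanForm_zero_left, euclideanForm_comm, euclideanForm_C_left, this, coeff_zero,
      sub_zero, absoluteTrace_zero]

theorem not_detects_xType {h : Fin n → F}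
    (hB : ∀ s ∈ rowModule B, s ⬝ᵥ (fun j => C (h j)) = 0)
    (hA : (fun j => C (h j)) ∉ rowModule A) :
    ¬ Detects (fromBlocks A 0 0 B) (Sum.elim (fun j => C (h j)) fun _ => 0) := by
  rintro (hmem | ⟨s, hs, hc⟩)
  · exact hA (mem_rowModule_fromBlocks.1 hmem).1
  · apply hc
    have := hB _ (mem_rowModule_fromBlocks.1 hs).2
    rw [PauliLabel.Commutes]
    simp only [Sum.elim_inl, Sum.elim_inr]
    rw [euclideanForm_zero_right, euclideanForm_C_left, this, coeff_zero,
      sub_zero, absoluteTrace_zero]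

/-- One undetected error makes the minimum weight well defined; the detection bound then bounds it
below. -/
theorem exists_hasFreeDistance {S : Matrix ι (Fin n ⊕ Fin n) F[X]} {P : PauliLabel F n → Prop}
    {d : ℕ} (h : ∀ E, P E → E.weight < d → Detects S E) {E : PauliLabel F n} (hE : P E)
    (hnot : ¬ Detects S E) : ∃ d', d ≤ d' ∧ HasFreeDistance S P d' := by
  classical
  have hex : ∃ w, ∃ E, P E ∧ E.weight = w ∧ ¬ Detects S E := ⟨_, E, hE, rfl, hnot⟩
  obtain ⟨E', hE', hw, hn⟩ := Nat.find_spec hex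
  refine ⟨Nat.find hex, ?_, fun E'' hP hlt => ?_, E', hE', hw, hn⟩
  · rw [← hw]
    exact not_lt.1 fun hlt => hn (h _ hE' hlt)
  · by_contra hd
    exact Nat.find_min hex hlt ⟨E'', hP, rfl, hd⟩

theorem symplecticOrthogonal_fromBlocks (hAB : toLaurentMatrix A * (toLaurentMatrixInv B)ᵀ = 0)
    (hBA : toLaurentMatrix B * (toLaurentMatrixInv A)ᵀ = 0) :
    SymplecticOrthogonal (fromBlocks A 0 0 B) := by
  rw [SymplecticOrthogonal, sub_eq_zero]
  refine Matrix.ext fun i j => ?_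
  cases i with
  | inl i =>
    cases j with
    | inl j => simp [Matrix.mul_apply, toLaurentMatrix, toLaurentMatrixInv]
    | inr j =>
      have := congrFun (congrFun hAB i) j
      simpa [Matrix.mul_apply, toLaurentMatrix, toLaurentMatrixInv] using this
  | inr i =>
    cases j with
    | inl j =>
      have := congrFun (congrFun hBA i) j
      simpa [Matrix.mul_apply, toLaurentMatrix, toLaurentMatrixInv, eq_comm] using this
    | inr j => simp [Matrix.mul_apply, toLaurentMatrix, toLaurentMatrixInv]

theorem overallConstraintLength_fromBlocks :
    overallConstraintLength (fromBlocks A 0 0 B)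
      = overallConstraintLength A + overallConstraintLength B := by
  simp only [overallConstraintLength, Fintype.sum_sum_type]
  congr 1 <;> refine Finset.sum_congr rfl fun i _ => eq_of_forall_ge_iff fun c => ?_ <;>
    simp [constraintLength]

variable [DecidableEq ι] [DecidableEq κ]

theorem isBasic_fromBlocks (hA : IsBasic A) (hB : IsBasic B) :
    IsBasic (fromBlocks A 0 0 B) := by
  obtain ⟨R, hR⟩ := hA
  obtain ⟨Q, hQ⟩ := hB
  refine ⟨Matrix.fromBlocks R 0 0 Q, ?_⟩
  simp [Matrix.fromBlocks_multiply, hR, hQ]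

end CSS


/-! ### Assembly of the quantum codes. -/

theorem coeff_zero_shiftedRow {F : Type*} [Field F] {ι m : Type*} [Fintype ι] [DecidableEq ι]
    [Fintype m] (G : Matrix (Option ι) m F) (i₀ : ι) {d : ℕ} (hd : d ≠ 0) (i : ι) (j : m) :
    (shiftedRow G i₀ d i j).coeff 0 = G (some i) j := by
  rw [shiftedRow_apply]
  split_ifs <;> simp [mul_coeff_zero, coeff_X_pow, hd.symm]

theorem isReducedBasic_fromBlocks_shiftedRow {F : Type*} [Field F] {n : ℕ}
    {ι κ : Type*} [Fintype ι] [Fintype κ] [DecidableEq ι] [DecidableEq κ]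
    {G : Matrix (Option ι) (Fin n) F} {H : Matrix (Option κ) (Fin n) F}
    (hG : LinearIndependent F G) (hH : LinearIndependent F H) (i₀ : ι) (k₀ : κ) (d e : ℕ) :
    IsReducedBasic (fromBlocks (shiftedRow G i₀ d) 0 0 (shiftedRow H k₀ e)) ∧
      overallConstraintLength (fromBlocks (shiftedRow G i₀ d) 0 0 (shiftedRow H k₀ e))
        = d + e := by
  obtain ⟨K, hK⟩ := exists_det_shiftedRow hG i₀ d
  obtain ⟨L, hL⟩ := exists_det_shiftedRow hH k₀ e
  have hdet : (fromBlocks (shiftedRow G i₀ d) 0 0 (shiftedRow H k₀ e)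
      * (fromBlocks K 0 0 L).map C).det.natDegree = d + e := by
    simp [Matrix.fromBlocks_map, Matrix.fromBlocks_multiply, Matrix.map_zero, hK, hL, ← pow_add]
  have hle : overallConstraintLength (fromBlocks (shiftedRow G i₀ d) 0 0 (shiftedRow H k₀ e))
      ≤ d + e := by
    rw [overallConstraintLength_fromBlocks]
    exact add_le_add (overallConstraintLength_shiftedRow_le _ _ _)
      (overallConstraintLength_shiftedRow_le _ _ _)
  refine ⟨isReducedBasic_of_natDegree_det
    (isBasic_fromBlocks (isBasic_shiftedRow hG i₀ d) (isBasic_shiftedRow hH k₀ e)) (fromBlocks K 0 0 L)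
    (hle.trans_eq hdet.symm), hle.antisymm ?_⟩
  rw [← hdet]
  exact natDegree_det_le_overallConstraintLength _ _

theorem exists_hasAsymmetricParameters_shiftedRow {F : Type*} [Field F] [Finite F] [DecidableEq F]
    {n : ℕ} {ι κ : Type*} [Fintype ι] [Fintype κ] [DecidableEq ι] [DecidableEq κ]
    {G : Matrix (Option ι) (Fin n) F} {H : Matrix (Option κ) (Fin n) F}
    (hG : LinearIndependent F G) (hH : LinearIndependent F H) (hGH : G * Hᵀ = 0) {r s : ℕ}
    (hGw : ∀ v : Fin n → F, v ≠ 0 → (Finset.univ.filter fun j => v j ≠ 0).card ≤ r →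
      ∃ i, ∑ j, G (some i) j * v j ≠ 0)
    (hHw : ∀ v : Fin n → F, v ≠ 0 → (Finset.univ.filter fun j => v j ≠ 0).card ≤ s →
      ∃ i, ∑ j, H (some i) j * v j ≠ 0)
    (i₀ : ι) (k₀ : κ) {d e : ℕ} (hd : d ≠ 0) (he : e ≠ 0) {k : ℕ}
    (hk : Fintype.card ι + Fintype.card κ + k = n) :
    ∃ μ dz dx, HasAsymmetricParameters
      (fromBlocks (shiftedRow G i₀ d) 0 0 (shiftedRow H k₀ e)) k μ (d + e) dz dx ∧
      r + 1 ≤ dz ∧ s + 1 ≤ dx := by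
  have hHG : H * Gᵀ = 0 := by
    rw [← Matrix.transpose_transpose H, ← Matrix.transpose_mul, hGH, Matrix.transpose_zero]
  obtain ⟨dz, hdz, hz⟩ := exists_hasFreeDistance (P := PauliLabel.IsZType)
    (fun E hE hw => detects_of_isZType (A := shiftedRow G i₀ d) (B := shiftedRow H k₀ e)
      (by simpa only [coeff_zero_shiftedRow G i₀ hd] using hGw) hE hw)
    -- The extra row of `H`, placed in frame 0, is orthogonal to every row of `G` but lies outside
    -- the module of the shifted `H`.
    (E := Sum.elim (fun _ => 0) fun j => C (H none j)) (fun _ => rfl)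
    (not_detects_zType (fun u hu => dotProduct_eq_zero_of_mem_rowModule
      (funext fun o => congrFun (congrFun hGH o) none) hu) (notMem_rowModule_shiftedRow hH k₀ e))
  obtain ⟨dx, hdx, hx⟩ := exists_hasFreeDistance (P := PauliLabel.IsXType)
    (fun E hE hw => detects_of_isXType (A := shiftedRow G i₀ d) (B := shiftedRow H k₀ e)
      (by simpa only [coeff_zero_shiftedRow H k₀ he] using hHw) hE hw)
    (E := Sum.elim (fun j => C (G none j)) fun _ => 0) (fun _ => rfl)
    (not_detects_xType (fun u hu => dotProduct_eq_zero_of_mem_rowModule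
      (funext fun o => congrFun (congrFun hHG o) none) hu) (notMem_rowModule_shiftedRow hG i₀ d))
  obtain ⟨hred, hdeg⟩ := isReducedBasic_fromBlocks_shiftedRow hG hH i₀ k₀ d e
  refine ⟨_, dz, dx, ⟨symplecticOrthogonal_fromBlocks (toLaurentMatrix_shiftedRow_mul hGH _ _ _ _)
    (toLaurentMatrix_shiftedRow_mul hHG _ _ _ _), hred, ?_, rfl, hdeg, hz, hx⟩, hdz, hdx⟩
  rw [Fintype.card_sum, hk]

theorem exists_linearIndependent_option_mul_transpose_eq_zero {F : Type*} [Field F] {n : ℕ}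
    {ι κ : Type*} [Fintype ι] [Fintype κ] {v : ι → Fin n → F} {w : κ → Fin n → F}
    (hv : LinearIndependent F v) (hw : LinearIndependent F w) (hvw : ∀ i j, v i ⬝ᵥ w j = 0)
    (hcard : Fintype.card ι + Fintype.card κ + 2 ≤ n) :
    ∃ (G : Matrix (Option ι) (Fin n) F) (H : Matrix (Option κ) (Fin n) F),
      (∀ i, G (some i) = v i) ∧ (∀ j, H (some j) = w j) ∧
      LinearIndependent F G ∧ LinearIndependent F H ∧ G * Hᵀ = 0 := by
  obtain ⟨y, hy, hyw⟩ := exists_dotProduct_eq_zero_notMem_span v w (by omega)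
  -- The vector `x` must also be orthogonal to the `y` already chosen, which is why two spare
  -- dimensions are needed.
  obtain ⟨x, hx, hxv⟩ := exists_dotProduct_eq_zero_notMem_span
    (fun o : Option κ => o.elim y w) v (by rw [Fintype.card_option]; omega)
  refine ⟨fun o => o.elim x v, fun o => o.elim y w, fun _ => rfl, fun _ => rfl,
    linearIndependent_option.2 ⟨hv, hxv⟩, linearIndependent_option.2 ⟨hw, hyw⟩, ?_⟩
  refine Matrix.ext fun i j => ?_
  change (i.elim x v : Fin n → F) ⬝ᵥ (j.elim y w : Fin n → F) = 0
  cases i with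
  | none => rw [dotProduct_comm]; exact hx j
  | some i =>
    cases j with
    | none => exact hy i
    | some j => exact hvw i j

theorem existsAQCC_of_add_eq {F : Type*} [Field F] [Fintype F] {n r s m d e : ℕ} (hr : 0 < r)
    (hs : 0 < s) (hm : 0 < m) (hn : n = Fintype.card F + 1) (hrs : r + s + 2 * m = n)
    (hd : d ≠ 0) (he : e ≠ 0) :
    ∃ μ dz dx, ExistsAQCC F n (2 * m) μ (d + e) dz dx ∧ r + 1 ≤ dz ∧ s + 1 ≤ dx := by
  classical
  obtain ⟨φ, hφ, hdeg, hroot⟩ := exists_monic_natDegree_eval_ne_zero F m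
  let f : Fin n ≃ Option F := Fintype.equivOfCardEq (by simp [hn])
  have hli : ∀ {t k : ℕ} {ψ : F[X]}, (∀ x, ψ.eval x ≠ 0) → t ≤ Fintype.card F →
      LinearIndependent F fun l : Fin t => projEval (t + k) (ψ * X ^ (l : ℕ)) ∘ f :=
    fun hψ ht => (linearIndependent_projEval hψ ht).map' (LinearMap.funLeft F F f)
      (LinearMap.ker_eq_bot.2 (LinearMap.funLeft_injective_of_surjective F F f f.surjective))
  have hwt : ∀ {t k : ℕ} {ψ : F[X]}, ψ.Monic → ψ.natDegree = k → (∀ x, ψ.eval x ≠ 0) →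
      ∀ v : Fin n → F, v ≠ 0 → (Finset.univ.filter fun j => v j ≠ 0).card ≤ t →
      ∃ l : Fin t, ∑ j, projEval (t + k) (ψ * X ^ (l : ℕ)) (f j) * v j ≠ 0 := by
    intro t k ψ hψ hk hψ0 v hv hcard
    obtain ⟨l, hl⟩ := exists_sum_projEval_ne_zero (v := v ∘ f.symm) hψ hk hψ0
      (fun h => hv (funext fun j => by simpa using congrFun h (f j)))
      (by
        refine le_trans (le_of_eq ?_) hcard
        simp only [Finset.card_filter]
        rw [← Equiv.sum_comp f]
        simp)
    refine ⟨l, ?_⟩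
    rw [← Equiv.sum_comp f] at hl
    simpa using hl
  obtain ⟨G, H, hG', hH', hG, hH, hGH⟩ := exists_linearIndependent_option_mul_transpose_eq_zero
    (hli (t := r) (k := 2 * m) hroot (by omega))
    (hli (t := s) (k := 0) (ψ := 1) (by simp) (by omega)) (by
      intro i j
      have h := sum_projEval_mul (r := r + 2 * m) (s := s + 0) (f := φ * X ^ (i : ℕ))
        (g := 1 * X ^ (j : ℕ)) (by omega) (by omega)
        (by rw [natDegree_mul_X_pow _ hφ.ne_zero, hdeg]; omega)
        (by rw [one_mul, natDegree_X_pow]; omega) (by omega)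
      rw [← Equiv.sum_comp f] at h
      exact h) (by simp only [Fintype.card_fin]; omega)
  obtain ⟨μ, dz, dx, hp, hz, hx⟩ := exists_hasAsymmetricParameters_shiftedRow hG hH hGH
    (by simpa only [hG', Function.comp_apply] using hwt hφ hdeg hroot)
    (by simpa only [hH', Function.comp_apply] using hwt monic_one natDegree_one (by simp))
    ⟨0, hr⟩ ⟨0, hs⟩ hd he (k := 2 * m) (by simpa using hrs)
  exact ⟨μ, dz, dx, ⟨_, _, _, _, hp⟩, hz, hx⟩

end

end QConv

theorem theorem4 (l q n a : ℕ) (hl : 4 ≤ l) (hq : q = 2 ^ l) (hn : n = q + 1) (ha : a = q / 2)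
    (F : Type*) [Field F] [Fintype F] (hF : Fintype.card F = q) :
    (∀ i t : ℕ, 1 ≤ t → t ≤ i - 2 → 3 ≤ i → i ≤ a - 1 →
      ∃ μ dz dx : ℕ, QConv.ExistsAQCC F n (2 * i - 2 * t - 2) μ 6 dz dx ∧
        n - 2 * i - 1 ≤ dz ∧ 2 * t + 3 ≤ dx) ∧
    (∀ i t : ℕ, 1 ≤ t → t ≤ i - 1 → 2 ≤ i → i ≤ a - 1 →
      ∃ μ dz dx : ℕ, QConv.ExistsAQCC F n (2 * i - 2 * t) μ 4 dz dx ∧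
        n - 2 * i - 1 ≤ dz ∧ 2 * t + 3 ≤ dx) := by
  refine ⟨fun i t ht hti hi hia => ?_, fun i t ht hti hi hia => ?_⟩
  -- The number of rows forces `s = 2t + 4`, so the construction even gives `dx ≥ 2t + 5`; the
  -- degree 6 is split as 3 + 3.
  · obtain ⟨μ, dz, dx, h, hz, hx⟩ := QConv.existsAQCC_of_add_eq (F := F) (n := n) (r := n - 2 * i - 2)
      (s := 2 * t + 4) (m := i - t - 1) (d := 3) (e := 3) (by omega) (by omega) (by omega)
      (by omega) (by omega) (by omega) (by omega)
    rw [show 2 * (i - t - 1) = 2 * i - 2 * t - 2 by omega] at h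
    exact ⟨μ, dz, dx, h, by omega, by omega⟩
  -- Here `s + 1` is exactly `2t + 3`, and the degree 4 is split as 2 + 2.
  · obtain ⟨μ, dz, dx, h, hz, hx⟩ := QConv.existsAQCC_of_add_eq (F := F) (n := n) (r := n - 2 * i - 2)
      (s := 2 * t + 2) (m := i - t) (d := 2) (e := 2) (by omega) (by omega) (by omega)
      (by omega) (by omega) (by omega) (by omega)
    rw [show 2 * (i - t) = 2 * i - 2 * t by omega] at h
    exact ⟨μ, dz, dx, h, by omega, by omega⟩
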